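/- Conventions. All spaces, maps and homotopies are pointed. $X$ is a connected CW complex of finite type (finitely many cells in each dimension) whose basepoint is a vertex, and $X^n$ is its $n$-skeleton. A map $f\colon X\to Y$ is a phantom map if $f|_{X^n}$ is null homotopic for every $n$; $\mathrm{Ph}(X,Y)$ is the set of homotopy classes of phantom maps $X\to Y$, and $\mathrm{Ph}(X,Y)=*$ means that it contains only the class of the constant map. For a map $\varphi\colon B\to Y$, a map $f\colon X\to Y$ is a phantom map relative to $\varphi$ if for every $n$ there is $g_n\colon X^n\to B$ with $\varphi\circ g_n\simeq f|_{X^n}$; $\mathrm{Ph}(X,\varphi)$ is the set of homotopy classes of such maps. It is called trivial if every element of $\mathrm{Ph}(X,\varphi)$ is the class of $\varphi\circ g$ for some $g\colon X\to B$. The pair $F\xrightarrow{i}E\xrightarrow{p}B$ is a homotopy fibration if there is a (pointed) homotopy equivalence $e$ from $F$ to the homotopy fiber of $p$ such that the composite of $e$ with the projection to $E$ is homotopic to $i$; a sequence of maps is a homotopy fibration sequence if any two consecutive maps form a homotopy fibration. $\Sigma X$ is the reduced suspension, with any structure of CW complex of finite type with the basepoint a vertex. (1) Let $B\xrightarrow{\varphi}Y\xrightarrow{\alpha}V\xrightarrow{\beta}W$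 be a homotopy fibration sequence such that either $\beta$ is null homotopic or $\mathrm{Ph}(X,W)=*$. Then $\mathrm{Ph}(X,\varphi)$ is trivial if and only if $\mathrm{Ph}(X,V)=*$. (2) Let $F\xrightarrow{j}B\xrightarrow{\varphi}Y$ be a homotopy fibration such that either $j$ is null homotopic or $\mathrm{Ph}(X,B)=*$. Then $\mathrm{Ph}(\Sigma X,\varphi)$ is trivial if and only if $\mathrm{Ph}(X,F)=*$. -/

import Mathlib

open scoped unitInterval

noncomputable section

/-- A pointed topological space. -/
structure PtdSpace where
  carrier : Type*
  [top : TopologicalSpace carrier]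
  pt : carrier

namespace PtdSpace

instance : CoeSort PtdSpace (Type _) := ⟨PtdSpace.carrier⟩

instance (X : PtdSpace) : TopologicalSpace X := X.top

/-- Basepoint preserving continuous maps. -/
structure Map (X Y : PtdSpace) where
  toFun : C(X, Y)
  map_pt : toFun X.pt = Y.pt

namespace Map

def id (X : PtdSpace) : Map X X := ⟨ContinuousMap.id X, rfl⟩

def comp {X Y Z : PtdSpace} (g : Map Y Z) (f : Map X Y) : Map X Z :=
  ⟨g.toFun.comp f.toFun, by simp [f.map_pt, g.map_pt]⟩

/-- The constant map at the basepoint. -/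
def const (X Y : PtdSpace) : Map X Y := ⟨ContinuousMap.const X Y.pt, rfl⟩

/-- Pointed homotopy: a homotopy that is stationary at the basepoint. -/
def Homotopic {X Y : PtdSpace} (f g : Map X Y) : Prop :=
  f.toFun.HomotopicRel g.toFun {X.pt}

/-- Pointed null homotopic maps. -/
def NullHomotopic {X Y : PtdSpace} (f : Map X Y) : Prop :=
  f.Homotopic (const X Y)

/-- `f : X → Y` lifts through `φ : B → Y`, up to (pointed) homotopy. -/
def LiftsUpToHomotopy {X B Y : PtdSpace} (f : Map X Y) (φ : Map B Y) : Prop :=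
  ∃ g : Map X B, (φ.comp g).Homotopic f

/-- Pointed homotopy equivalences. -/
def IsHomotopyEquiv {X Y : PtdSpace} (f : Map X Y) : Prop :=
  ∃ g : Map Y X, (g.comp f).Homotopic (id X) ∧ (f.comp g).Homotopic (id Y)

/-- The relation of pointed homotopy is an equivalence relation. -/
def setoid (X Y : PtdSpace) : Setoid (Map X Y) where
  r := Homotopic
  iseqv := ⟨fun f => ContinuousMap.HomotopicRel.refl f.toFun,
    fun h => ContinuousMap.HomotopicRel.symm h,
    fun h₁ h₂ => ContinuousMap.HomotopicRel.trans h₁ h₂⟩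

end Map

/-- The set `[X, Y]` of pointed homotopy classes of pointed maps. -/
def HtpyClass (X Y : PtdSpace) : Type _ := Quotient (Map.setoid X Y)

/-- The pointed homotopy class of a pointed map. -/
def Map.cls {X Y : PtdSpace} (f : Map X Y) : HtpyClass X Y :=
  Quotient.mk (Map.setoid X Y) f

/-- The homotopy fiber of `p : E → B`: pairs `(e, γ)` of a point `e` of `E` and a path `γ` in `B`
from `p e` to the basepoint of `B`. -/
def hofiber {E B : PtdSpace} (p : Map E B) : PtdSpace where
  carrier := {q : E × C(I, B) // q.2 0 = p.toFun q.1 ∧ q.2 1 = B.pt}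
  pt := ⟨(E.pt, ContinuousMap.const I B.pt), p.map_pt.symm, rfl⟩

/-- The projection of the homotopy fiber of `p : E → B` to `E`. -/
def hofiberProj {E B : PtdSpace} (p : Map E B) : Map (hofiber p) E where
  toFun := ⟨fun q => q.1.1, continuous_fst.comp continuous_subtype_val⟩
  map_pt := rfl

/-- `F → E → B` is a homotopy fibration: up to homotopy, `i : F → E` is identified with the
projection of the homotopy fiber of `p` to `E` by a homotopy equivalence. -/
def IsHomotopyFibration {F E B : PtdSpace} (i : Map F E) (p : Map E B) : Prop :=
  ∃ e : Map F (hofiber p), e.IsHomotopyEquiv ∧ ((hofiberProj p).comp e).Homotopic i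

/-- The part of `X × [0, 1]` collapsed to the basepoint in the reduced suspension of `X`. -/
def suspBase (X : PtdSpace) : Set (X × I) := {p | p.1 = X.pt ∨ p.2 = 0 ∨ p.2 = 1}

def suspSetoid (X : PtdSpace) : Setoid (X × I) where
  r p q := p = q ∨ (p ∈ suspBase X ∧ q ∈ suspBase X)
  iseqv := ⟨fun _ => Or.inl rfl,
    fun h => h.imp Eq.symm And.symm,
    by
      rintro p q r (rfl | ⟨hp, hq⟩) (rfl | ⟨hq', hr⟩)
      · exact Or.inl rfl
      · exact Or.inr ⟨hq', hr⟩
      · exact Or.inr ⟨hp, hq⟩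
      · exact Or.inr ⟨hp, hr⟩⟩

/-- The reduced suspension of a pointed space. -/
def susp (X : PtdSpace) : PtdSpace where
  carrier := Quotient (suspSetoid X)
  pt := Quotient.mk (suspSetoid X) (X.pt, 0)

/-- A structure of connected CW complex of finite type on the pointed space `X`, with the basepoint
a vertex. -/
structure CWStructure (X : PtdSpace) where
  t2 : T2Space X
  connected : ConnectedSpace X
  cw : Topology.CWComplex (Set.univ : Set X)
  finiteType : Topology.CWComplex.FiniteType (Set.univ : Set X)
  pt_mem : X.pt ∈ Topology.CWComplex.skeleton (Set.univ : Set X) 0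

namespace CWStructure

variable {X : PtdSpace}

/-- The underlying set of the `n`-skeleton. -/
def skelSet (K : CWStructure X) (n : ℕ) : Set X :=
  letI := K.t2
  letI := K.cw
  (Topology.CWComplex.skeleton (Set.univ : Set X) (n : ℕ∞) : Set X)

theorem pt_mem_skelSet (K : CWStructure X) (n : ℕ) : X.pt ∈ K.skelSet n := by
  let := K.t2
  let := K.cw
  exact Topology.CWComplex.skeleton_mono (C := (Set.univ : Set X)) (zero_le (a := (n : ℕ∞))) K.pt_mem

/-- The `n`-skeleton, as a pointed space. -/
def skel (K : CWStructure X) (n : ℕ) : PtdSpace where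
  carrier := K.skelSet n
  pt := ⟨X.pt, K.pt_mem_skelSet n⟩

/-- The inclusion of the `n`-skeleton. -/
def incl (K : CWStructure X) (n : ℕ) : Map (K.skel n) X where
  toFun := ⟨Subtype.val, continuous_subtype_val⟩
  map_pt := rfl

/-- `f : X → Y` is an (absolute) phantom map: its restriction to every finite dimensional skeleton
of `X` is null homotopic. -/
def IsPhantom (K : CWStructure X) {Y : PtdSpace} (f : Map X Y) : Prop :=
  ∀ n : ℕ, (f.comp (K.incl n)).NullHomotopic

/-- `f : X → Y` is a phantom map relative to `φ : B → Y`: its restriction to every finite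
dimensional skeleton of `X` lifts through `φ`, up to homotopy. -/
def IsRelPhantom (K : CWStructure X) {B Y : PtdSpace} (φ : Map B Y) (f : Map X Y) : Prop :=
  ∀ n : ℕ, (f.comp (K.incl n)).LiftsUpToHomotopy φ

/-- `Ph(X, Y)`: the set of homotopy classes of phantom maps from `X` to `Y`. -/
def Ph (K : CWStructure X) (Y : PtdSpace) : Set (HtpyClass X Y) :=
  {c | ∃ f : Map X Y, K.IsPhantom f ∧ f.cls = c}

/-- `Ph(X, φ)`: the set of homotopy classes of phantom maps from `X` to `Y` relative to `φ`. -/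
def RelPh (K : CWStructure X) {B Y : PtdSpace} (φ : Map B Y) : Set (HtpyClass X Y) :=
  {c | ∃ f : Map X Y, K.IsRelPhantom φ f ∧ f.cls = c}

/-- `Ph(X, Y) = *`: the class of the constant map is the only element of `Ph(X, Y)`. -/
def PhEqPoint (K : CWStructure X) (Y : PtdSpace) : Prop :=
  K.Ph Y = {(Map.const X Y).cls}

/-- `Ph(X, φ)` is trivial: each of its elements is represented by a map `X → Y` that lifts
through `φ`, up to homotopy. -/
def RelPhTrivial (K : CWStructure X) {B Y : PtdSpace} (φ : Map B Y) : Prop :=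
  ∀ c ∈ K.RelPh φ, ∃ f : Map X Y, f.LiftsUpToHomotopy φ ∧ f.cls = c

end CWStructure

end PtdSpace

end

/-! Everything rests on exactness of pointed sets `[Z, F] → [Z, E] → [Z, B]` for a homotopy
fibration. With `Z` a skeleton of `X`, exactness at `Y` says that `f` is phantom relative to `φ` iff
`α ∘ f` is phantom; with `Z = X`, that `f` lifts iff `α ∘ f` is null. So triviality means that
phantoms of the form `α ∘ f` vanish. Either hypothesis on `β` makes `β ∘ g` null for every phantom
`g` into `V`, and exactness at `V` then puts `g` in that form (`relPhTrivial_iff_phEqPoint`).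

Part (2) is the same argument for the Puppe sequence `ΩB → ΩY → F → B` (`exists_isCoexact`), after
identifying relative phantoms `ΣX → Y` with relative phantoms `X → ΩY` by adjunction
(`relPhTrivial_susp_iff`). The CW structure on `ΣX` is arbitrary, so its skeleta are compared with
the suspended skeleta of `X` by compactness (`isRelPhantom_susp_iff`). -/

namespace PtdSpace

open Set Topology

/-! ### Pointed homotopy calculus -/

namespace Map

theorem ext {X Y : PtdSpace} {f g : Map X Y} (h : ∀ x, f.toFun x = g.toFun x) : f = g := by
  cases f; cases g
  congr
  exact ContinuousMap.ext h

theorem comp_const {X Y Z : PtdSpace} (g : Map Y Z) : g.comp (const X Y) = const X Z :=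
  ext fun _ => g.map_pt

namespace Homotopic

variable {X Y Z : PtdSpace}

theorem refl (f : Map X Y) : f.Homotopic f := ContinuousMap.HomotopicRel.refl f.toFun

theorem symm {f g : Map X Y} (h : f.Homotopic g) : g.Homotopic f :=
  ContinuousMap.HomotopicRel.symm h

theorem trans {f g h : Map X Y} (h₁ : f.Homotopic g) (h₂ : g.Homotopic h) : f.Homotopic h :=
  ContinuousMap.HomotopicRel.trans h₁ h₂

theorem of_continuous {f g : Map X Y} (H : I × X → Y) (hH : Continuous H)
    (h₀ : ∀ x, H (0, x) = f.toFun x) (h₁ : ∀ x, H (1, x) = g.toFun x)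
    (hpt : ∀ s, H (s, X.pt) = Y.pt) : f.Homotopic g :=
  ⟨{ toFun := H
     continuous_toFun := hH
     map_zero_left := h₀
     map_one_left := h₁
     prop' := by
      rintro s x rfl
      exact (hpt s).trans f.map_pt.symm }⟩

theorem exists_continuous {f g : Map X Y} (h : f.Homotopic g) :
    ∃ H : C(I × X, Y), (∀ x, H (0, x) = f.toFun x) ∧ (∀ x, H (1, x) = g.toFun x) ∧
      ∀ s, H (s, X.pt) = Y.pt := by
  obtain ⟨H⟩ := h
  refine ⟨H.toContinuousMap, H.map_zero_left, H.map_one_left, fun s => ?_⟩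
  exact (H.eq_fst s rfl).trans f.map_pt

theorem comp_left {f g : Map X Y} (h : f.Homotopic g) (k : Map Y Z) :
    (k.comp f).Homotopic (k.comp g) := by
  obtain ⟨H, h₀, h₁, hpt⟩ := h.exists_continuous
  refine of_continuous (fun p => k.toFun (H p)) (by fun_prop) (fun x => ?_) (fun x => ?_)
    (fun s => ?_)
  · rw [h₀]; rfl
  · rw [h₁]; rfl
  · rw [hpt, k.map_pt]

theorem comp_right {f g : Map Y Z} (h : f.Homotopic g) (k : Map X Y) :
    (f.comp k).Homotopic (g.comp k) := by
  obtain ⟨H, h₀, h₁, hpt⟩ := h.exists_continuous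
  refine of_continuous (fun p => H (p.1, k.toFun p.2)) (by fun_prop) (fun x => ?_) (fun x => ?_)
    (fun s => ?_)
  · rw [h₀]; rfl
  · rw [h₁]; rfl
  · rw [k.map_pt, hpt]

end Homotopic

namespace NullHomotopic

variable {X Y Z : PtdSpace}

theorem comp_left {f : Map X Y} (h : f.NullHomotopic) (k : Map Y Z) :
    (k.comp f).NullHomotopic := by
  have := Homotopic.comp_left h k
  rwa [comp_const] at this

theorem comp_right {f : Map Y Z} (h : f.NullHomotopic) (k : Map X Y) :
    (f.comp k).NullHomotopic :=
  Homotopic.comp_right h k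

theorem congr {f g : Map X Y} (h : f.NullHomotopic) (hfg : g.Homotopic f) : g.NullHomotopic :=
  hfg.trans h

end NullHomotopic

theorem LiftsUpToHomotopy.congr {X B Y : PtdSpace} {f g : Map X Y} {φ : Map B Y}
    (h : f.LiftsUpToHomotopy φ) (hfg : f.Homotopic g) : g.LiftsUpToHomotopy φ :=
  h.imp fun _ hk => hk.trans hfg

theorem LiftsUpToHomotopy.comp_right {X Z B Y : PtdSpace} {f : Map X Y} {φ : Map B Y}
    (h : f.LiftsUpToHomotopy φ) (k : Map Z X) : (f.comp k).LiftsUpToHomotopy φ := by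
  obtain ⟨g, hg⟩ := h
  exact ⟨g.comp k, hg.comp_right k⟩

theorem cls_eq_cls {X Y : PtdSpace} {f g : Map X Y} : f.cls = g.cls ↔ f.Homotopic g :=
  Quotient.eq (r := setoid X Y)

end Map

open Map

/-! ### Phantom sets in terms of representatives -/

namespace CWStructure

variable {X : PtdSpace} (K : CWStructure X)

theorem phEqPoint_iff (Y : PtdSpace) :
    K.PhEqPoint Y ↔ ∀ f : Map X Y, K.IsPhantom f → f.NullHomotopic := by
  constructor
  · intro h f hf
    have : f.cls ∈ K.Ph Y := ⟨f, hf, rfl⟩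
    rw [h] at this
    exact cls_eq_cls.1 this
  · intro h
    apply Subset.antisymm
    · rintro _ ⟨f, hf, rfl⟩
      exact cls_eq_cls.2 (h f hf)
    · rintro _ rfl
      exact ⟨const X Y, fun n => Homotopic.refl (const (K.skel n) Y), rfl⟩

theorem relPhTrivial_iff {B Y : PtdSpace} (φ : Map B Y) :
    K.RelPhTrivial φ ↔ ∀ f : Map X Y, K.IsRelPhantom φ f → f.LiftsUpToHomotopy φ := by
  constructor
  · intro h f hf
    obtain ⟨g, hg, hgf⟩ := h _ ⟨f, hf, rfl⟩
    exact hg.congr (cls_eq_cls.1 hgf)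
  · rintro h _ ⟨f, hf, rfl⟩
    exact ⟨f, h f hf, rfl⟩

end CWStructure

/-- Exactness of `[Z, F] → [Z, E] → [Z, B]` at `[Z, E]` for all pointed spaces `Z`. -/
def IsCoexact.{u, v, w, z} {F : PtdSpace.{u}} {E : PtdSpace.{v}} {B : PtdSpace.{w}}
    (i : Map F E) (p : Map E B) : Prop :=
  ∀ (Z : PtdSpace.{z}) (f : Map Z E), (p.comp f).NullHomotopic ↔ f.LiftsUpToHomotopy i

/-- Only exactness on spaces in the universe of `X` enters, so the argument serves both the given
sequence and the looped one. -/
theorem CWStructure.relPhTrivial_iff_phEqPoint.{x, b, y, v, w} {X : PtdSpace.{x}}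
    (K : CWStructure X) {B : PtdSpace.{b}} {Y : PtdSpace.{y}} {V : PtdSpace.{v}}
    {W : PtdSpace.{w}} {φ : Map B Y} {α : Map Y V} {β : Map V W}
    (h₁ : IsCoexact.{b, y, v, x} φ α) (h₂ : IsCoexact.{y, v, w, x} α β)
    (h : β.NullHomotopic ∨ K.PhEqPoint W) : K.RelPhTrivial φ ↔ K.PhEqPoint V := by
  have key (f : Map X Y) : K.IsRelPhantom φ f ↔ K.IsPhantom (α.comp f) :=
    forall_congr' fun n => (h₁ _ _).symm
  rw [K.relPhTrivial_iff, K.phEqPoint_iff]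
  rw [K.phEqPoint_iff] at h
  constructor
  · intro ht g hg
    have hβ : (β.comp g).NullHomotopic :=
      h.elim (fun hβ => hβ.comp_right g) fun hW => hW _ fun n => (hg n).comp_left β
    obtain ⟨f, hf⟩ := (h₂ _ _).1 hβ
    have hph : K.IsPhantom (α.comp f) := fun n => (hg n).congr (hf.comp_right _)
    exact ((h₁ _ _).2 (ht f ((key f).2 hph))).congr hf.symm
  · intro hV f hf
    exact (h₁ _ _).1 (hV _ ((key f).1 hf))

/-! ### Exactness of homotopy fibrations -/

section hofiber

variable {E B Z : PtdSpace}

/-- The map to the homotopy fiber of `p` given by a map `f` to `E` and a null homotopy of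
`p ∘ f`. -/
def Map.toHofiber {p : Map E B} (f : Map Z E) (G : C(Z × I, B))
    (h₀ : ∀ z, G (z, 0) = p.toFun (f.toFun z)) (h₁ : ∀ z, G (z, 1) = B.pt)
    (hpt : ∀ t, G (Z.pt, t) = B.pt) : Map Z (hofiber p) where
  toFun := ⟨fun z => ⟨(f.toFun z, G.curry z), h₀ z, h₁ z⟩,
    (f.toFun.continuous.prodMk G.curry.continuous).subtype_mk _⟩
  map_pt := Subtype.ext (Prod.ext f.map_pt (ContinuousMap.ext hpt))

/-- A strict lift of `f` to the homotopy fiber is the same thing as a pointed null homotopy of `p ∘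
f`. -/
theorem isCoexact_hofiberProj (p : Map E B) : IsCoexact (hofiberProj p) p := by
  intro Z f
  constructor
  · intro h
    obtain ⟨H, h₀, h₁, hpt⟩ := h.exists_continuous
    exact ⟨Map.toHofiber f (H.comp ⟨Prod.swap, continuous_swap⟩) h₀ h₁ hpt, Homotopic.refl _⟩
  · rintro ⟨g, hg⟩
    refine NullHomotopic.congr ?_ (hg.symm.comp_left p)
    refine Homotopic.of_continuous (fun q => (g.toFun q.2).1.2 q.1) ?_ (fun z => ?_) (fun z => ?_)
      (fun s => ?_)
    · have : Continuous fun z => (g.toFun z).1.2 :=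
        continuous_snd.comp (continuous_subtype_val.comp g.toFun.continuous)
      fun_prop
    · exact (g.toFun z).2.1
    · exact (g.toFun z).2.2
    · rw [g.map_pt]; rfl

theorem IsHomotopyFibration.isCoexact {F E B : PtdSpace} {i : Map F E} {p : Map E B}
    (h : IsHomotopyFibration i p) : IsCoexact i p := by
  obtain ⟨e, ⟨e', he'e, hee'⟩, hi⟩ := h
  intro Z f
  rw [isCoexact_hofiberProj p Z f]
  constructor
  · rintro ⟨g, hg⟩
    refine ⟨e'.comp g, ((hi.symm.comp_right _).trans ?_).trans hg⟩
    exact ((hee'.comp_right g).comp_left (hofiberProj p) :)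
  · rintro ⟨g, hg⟩
    exact ⟨e.comp g, (hi.comp_right g).trans hg⟩

end hofiber

/-! ### Loop spaces and the Puppe sequence -/

/-- The loop space of a pointed space. -/
def loop (Y : PtdSpace) : PtdSpace where
  carrier := {γ : C(I, Y) // γ 0 = Y.pt ∧ γ 1 = Y.pt}
  pt := ⟨ContinuousMap.const I Y.pt, rfl, rfl⟩

/-- The map to the loop space of `Y` given by a family of loops. -/
def Map.toLoop {Z Y : PtdSpace} (G : C(Z × I, Y)) (h₀ : ∀ z, G (z, 0) = Y.pt)
    (h₁ : ∀ z, G (z, 1) = Y.pt) (hpt : ∀ t, G (Z.pt, t) = Y.pt) : Map Z (loop Y) where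
  toFun := ⟨fun z => ⟨G.curry z, h₀ z, h₁ z⟩, G.curry.continuous.subtype_mk _⟩
  map_pt := Subtype.ext (ContinuousMap.ext hpt)

/-- The family of loops given by a map to the loop space. -/
def Map.ofLoop {Z Y : PtdSpace} (f : Map Z (loop Y)) : C(Z × I, Y) :=
  ContinuousMap.uncurry ⟨fun z => (f.toFun z).1, continuous_subtype_val.comp f.toFun.continuous⟩

section ofLoop

variable {Z Y : PtdSpace} (f : Map Z (loop Y))

theorem Map.ofLoop_apply (z : Z) (t : I) : f.ofLoop (z, t) = (f.toFun z).1 t := rfl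

theorem Map.ofLoop_zero (z : Z) : f.ofLoop (z, 0) = Y.pt := (f.toFun z).2.1

theorem Map.ofLoop_one (z : Z) : f.ofLoop (z, 1) = Y.pt := (f.toFun z).2.2

theorem Map.ofLoop_pt (t : I) : f.ofLoop (Z.pt, t) = Y.pt := by
  rw [ofLoop_apply, f.map_pt]; rfl

theorem Map.homotopic_of_ofLoop {f g : Map Z (loop Y)} (H : (I × Z) × I → Y) (hH : Continuous H)
    (h₀ : ∀ z t, H ((0, z), t) = f.ofLoop (z, t)) (h₁ : ∀ z t, H ((1, z), t) = g.ofLoop (z, t))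
    (hpt : ∀ s t, H ((s, Z.pt), t) = Y.pt) (hl : ∀ q, H (q, 0) = Y.pt) (hr : ∀ q, H (q, 1) = Y.pt) :
    f.Homotopic g :=
  Homotopic.of_continuous
    (fun q => (⟨ContinuousMap.curry ⟨H, hH⟩ q, hl q, hr q⟩ : {γ : C(I, Y) // γ 0 = Y.pt ∧ γ 1 = Y.pt}))
    ((ContinuousMap.curry ⟨H, hH⟩).continuous.subtype_mk _)
    (fun z => Subtype.ext (ContinuousMap.ext (h₀ z)))
    (fun z => Subtype.ext (ContinuousMap.ext (h₁ z)))
    (fun s => Subtype.ext (ContinuousMap.ext (hpt s)))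

end ofLoop

/-- The map of loop spaces induced by a pointed map. -/
def loopMap {B Y : PtdSpace} (φ : Map B Y) : Map (loop B) (loop Y) :=
  toLoop (φ.toFun.comp (Map.id (loop B)).ofLoop)
    (fun z => (congrArg _ (ofLoop_zero _ z)).trans φ.map_pt)
    (fun z => (congrArg _ (ofLoop_one _ z)).trans φ.map_pt) (fun _ => φ.map_pt)

/-- The inclusion of the loop space of the base into the homotopy fiber. -/
def loopToHofiber {B Y : PtdSpace} (φ : Map B Y) : Map (loop Y) (hofiber φ) :=
  Map.toHofiber (const (loop Y) B) (Map.id (loop Y)).ofLoop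
    (fun z => (ofLoop_zero _ z).trans φ.map_pt.symm) (ofLoop_one _) (fun _ => rfl)

theorem homotopic_hofiber_of {Z B Y : PtdSpace} {φ : Map B Y} {f g : Map Z (hofiber φ)}
    (b : I × Z → B) (hb : Continuous b) (H : (I × Z) × I → Y) (hH : Continuous H)
    (hb₀ : ∀ z, b (0, z) = (f.toFun z).1.1) (hb₁ : ∀ z, b (1, z) = (g.toFun z).1.1)
    (hbpt : ∀ s, b (s, Z.pt) = B.pt)
    (h₀ : ∀ z t, H ((0, z), t) = (f.toFun z).1.2 t) (h₁ : ∀ z t, H ((1, z), t) = (g.toFun z).1.2 t)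
    (hpt : ∀ s t, H ((s, Z.pt), t) = Y.pt) (hl : ∀ q, H (q, 0) = φ.toFun (b q))
    (hr : ∀ q, H (q, 1) = Y.pt) : f.Homotopic g :=
  Homotopic.of_continuous
    (fun q => (⟨(b q, ContinuousMap.curry ⟨H, hH⟩ q), hl q, hr q⟩ :
      {q : B × C(I, Y) // q.2 0 = φ.toFun q.1 ∧ q.2 1 = Y.pt}))
    ((hb.prodMk (ContinuousMap.curry ⟨H, hH⟩).continuous).subtype_mk _)
    (fun z => Subtype.ext (Prod.ext (hb₀ z) (ContinuousMap.ext (h₀ z))))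
    (fun z => Subtype.ext (Prod.ext (hb₁ z) (ContinuousMap.ext (h₁ z))))
    (fun s => Subtype.ext (Prod.ext (hbpt s) (ContinuousMap.ext (hpt s))))

section Puppe

variable {B Y : PtdSpace} (φ : Map B Y)

/-- Homotopy lifting for the projection: a null homotopy of the `B`-component is followed by
lengthening the paths in `Y`. At its end the `B`-component is the basepoint, so the paths are loops.
-/
theorem isCoexact_loopToHofiber : IsCoexact (loopToHofiber φ) (hofiberProj φ) := by
  intro Z g
  constructor
  · intro h
    obtain ⟨h, h₀, h₁, hpt⟩ := h.exists_continuous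
    have hγ : Continuous fun z => (g.toFun z).1.2 :=
      continuous_snd.comp (continuous_subtype_val.comp g.toFun.continuous)
    -- At time `s`, the path runs back along `φ ∘ h` from `s` to `0` and then along the original
    -- path, at constant speed over total length `1 + s`.
    let P : (I × Z) × I → Y := fun q =>
      if (1 + q.1.1 : ℝ) * q.2 ≤ q.1.1 then
        φ.toFun (h (projIcc 0 1 zero_le_one (q.1.1 - (1 + q.1.1) * q.2 : ℝ), q.1.2))
      else (g.toFun q.1.2).1.2 (projIcc 0 1 zero_le_one ((1 + q.1.1) * q.2 - q.1.1 : ℝ))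
    have hP : Continuous P := by
      refine Continuous.if_le ?_ ?_ (by fun_prop) (by fun_prop) ?_
      · have : Continuous (projIcc (0 : ℝ) 1 zero_le_one) := continuous_projIcc
        fun_prop
      · have : Continuous (projIcc (0 : ℝ) 1 zero_le_one) := continuous_projIcc
        fun_prop
      · rintro ⟨⟨s, z⟩, t⟩ hst
        simp only at hst ⊢
        rw [hst, sub_self, projIcc_left]
        exact (congrArg φ.toFun (h₀ z)).trans (g.toFun z).2.1.symm
    have hP0 (s z) : P ((s, z), 0) = φ.toFun (h (s, z)) := by
      simp [P, s.2.1]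
    have hP1 (s z) : P ((s, z), 1) = Y.pt := by
      simp only [P, Icc.coe_one, mul_one]
      rw [if_neg (by linarith), add_sub_cancel_right, projIcc_right]
      exact (g.toFun z).2.2
    have hPpt (s t) : P ((s, Z.pt), t) = Y.pt := by
      simp only [P, hpt, φ.map_pt, g.map_pt]
      exact ite_self _
    have hP00 (z t) : P ((0, z), t) = (g.toFun z).1.2 t := by
      simp only [P, Icc.coe_zero, add_zero, one_mul, sub_zero, projIcc_val]
      split_ifs with ht
      · have : t = 0 := le_antisymm ht t.2.1
        subst this
        simp only [Icc.coe_zero, sub_zero, projIcc_left]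
        exact (congrArg φ.toFun (h₀ z)).trans (g.toFun z).2.1.symm
      · rfl
    refine ⟨toLoop (Z := Z) ⟨fun q => P ((1, q.1), q.2), by fun_prop⟩
      (fun z => (hP0 1 z).trans ?_) (hP1 1) (hPpt 1), Homotopic.symm ?_⟩
    · rw [h₁]; exact φ.map_pt
    · exact homotopic_hofiber_of h h.continuous P hP h₀ h₁ hpt hP00 (fun _ _ => rfl) hPpt
        (fun q => hP0 q.1 q.2) (fun q => hP1 q.1 q.2)
  · rintro ⟨k, hk⟩
    exact Homotopic.comp_left hk.symm (hofiberProj φ)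

/-- A null homotopy into the homotopy fiber traces a loop `b` in `B` and a square `Γ` in `Y` with
`f` on the edge `s = 0`, `φ ∘ b` on the edge `t = 0`, and the basepoint on the other two. Sweeping
across the square deforms `f` to `φ ∘ b`. -/
theorem isCoexact_loopMap : IsCoexact (loopMap φ) (loopToHofiber φ) := by
  intro Z f
  constructor
  · intro h
    obtain ⟨H, h₀, h₁, hpt⟩ := h.exists_continuous
    let Γ : C((I × Z) × I, Y) := ContinuousMap.uncurry
      ⟨fun q => (H q).1.2, continuous_snd.comp (continuous_subtype_val.comp H.continuous)⟩
    have hΓ0 (s z) : Γ ((s, z), 0) = φ.toFun (H (s, z)).1.1 := (H (s, z)).2.1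
    have hΓ1 (s z) : Γ ((s, z), 1) = Y.pt := (H (s, z)).2.2
    have hΓl (z t) : Γ ((0, z), t) = f.ofLoop (z, t) := by
      change (H (0, z)).1.2 t = _
      rw [h₀]; rfl
    have hΓr (z t) : Γ ((1, z), t) = Y.pt := by
      change (H (1, z)).1.2 t = _
      rw [h₁]; rfl
    have hΓpt (s t) : Γ ((s, Z.pt), t) = Y.pt := by
      change (H (s, Z.pt)).1.2 t = _
      rw [hpt]; rfl
    let b : C(Z × I, B) := ⟨fun q => (H (q.2, q.1)).1.1, continuous_fst.comp
      (continuous_subtype_val.comp (H.continuous.comp continuous_swap))⟩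
    refine ⟨toLoop b (fun z => ?_) (fun z => ?_) (fun t => ?_), Homotopic.symm ?_⟩
    · change (H (0, z)).1.1 = _
      rw [h₀]; rfl
    · change (H (1, z)).1.1 = _
      rw [h₁]; rfl
    · change (H (t, Z.pt)).1.1 = _
      rw [hpt]; rfl
    · have c1 : Continuous fun q : (I × Z) × I => projIcc (0 : ℝ) 1 zero_le_one (2 * q.1.1) :=
        continuous_projIcc.comp (by fun_prop)
      have c2 : Continuous fun q : (I × Z) × I =>
          projIcc (0 : ℝ) 1 zero_le_one (2 * (1 - q.1.1)) :=
        continuous_projIcc.comp (by fun_prop)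
      -- The loops run along segments from the corner `(0, 0)`; their far end moves from `(0, 1)`
      -- through `(1, 1)` to `(1, 0)`, always on the edges where `Γ` is the basepoint.
      refine homotopic_of_ofLoop (fun q => Γ ((projIcc 0 1 zero_le_one (2 * q.1.1 : ℝ) * q.2, q.1.2),
        projIcc 0 1 zero_le_one (2 * (1 - q.1.1) : ℝ) * q.2)) (by fun_prop) (fun z t => ?_)
        (fun z t => ?_) (fun s t => hΓpt _ _) (fun q => ?_) (fun q => ?_)
      · have : projIcc (0 : ℝ) 1 zero_le_one (2 * (1 - (0 : I))) = 1 :=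
          projIcc_of_right_le _ (by norm_num)
        simp only [this]
        simp [hΓl]
      · have : projIcc (0 : ℝ) 1 zero_le_one (2 * (1 : I)) = 1 :=
          projIcc_of_right_le _ (by norm_num)
        simp only [this]
        simp only [Icc.coe_one, sub_self, mul_zero, projIcc_left, one_mul]
        refine (congrArg (fun u => Γ ((t, z), u)) (zero_mul t)).trans ((hΓ0 t z).trans ?_)
        rfl
      · simp [hΓl, ofLoop_zero]
      · simp only [mul_one]
        rcases le_total (1 / 2 : ℝ) q.1.1 with hs | hs
        · rw [projIcc_of_right_le (x := (2 * q.1.1 : ℝ)) _ (by linarith)]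
          exact hΓr _ _
        · rw [projIcc_of_right_le (x := (2 * (1 - q.1.1) : ℝ)) _ (by linarith)]
          exact hΓ1 _ _
  · rintro ⟨g, hg⟩
    refine NullHomotopic.congr ?_ (hg.symm.comp_left (loopToHofiber φ))
    -- At time `s`, the `B`-component is `g` at `s`, and the path is the part of `φ ∘ g` from `s` to
    -- `1`, kept waiting at its start.
    refine homotopic_hofiber_of (fun q => g.ofLoop (q.2, q.1)) (by fun_prop)
      (fun q => φ.toFun (g.ofLoop (q.1.2, max q.1.1 q.2))) (by fun_prop) (fun z => ?_) (fun z => ?_)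
      (fun s => ?_) (fun z t => ?_) (fun z t => ?_) (fun s t => ?_) (fun q => ?_) (fun q => ?_)
    · exact g.ofLoop_zero z
    · exact g.ofLoop_one z
    · exact g.ofLoop_pt s
    · exact congrArg (fun u => φ.toFun (g.ofLoop (z, u))) (max_eq_right t.2.1)
    · refine (congrArg (fun u => φ.toFun (g.ofLoop (z, u))) (max_eq_left t.2.2)).trans ?_
      exact (congrArg φ.toFun (g.ofLoop_one z)).trans φ.map_pt
    · rw [ofLoop_pt, φ.map_pt]
    · exact congrArg (fun u => φ.toFun (g.ofLoop (q.2, u))) (max_eq_left q.1.2.1)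
    · refine (congrArg (fun u => φ.toFun (g.ofLoop (q.2, u))) (max_eq_right q.1.2.2)).trans ?_
      exact (congrArg φ.toFun (g.ofLoop_one q.2)).trans φ.map_pt

end Puppe

/-- The connecting map is `loopToHofiber φ` followed by a homotopy inverse of the equivalence from
`F` to the homotopy fiber. -/
theorem IsHomotopyFibration.exists_isCoexact.{f, b, y, z} {F : PtdSpace.{f}} {B : PtdSpace.{b}}
    {Y : PtdSpace.{y}} {j : Map F B} {φ : Map B Y} (h : IsHomotopyFibration j φ) :
    ∃ δ : Map (loop Y) F, IsCoexact.{b, y, f, z} (loopMap φ) δ ∧ IsCoexact.{y, f, b, z} δ j := by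
  obtain ⟨e, ⟨e', he'e, hee'⟩, hj⟩ := h
  refine ⟨e'.comp (loopToHofiber φ), fun Z f => ?_, fun Z f => ?_⟩
  · rw [← isCoexact_loopMap φ Z f]
    constructor
    · intro h
      exact (h.comp_left e).congr (hee'.symm.comp_right ((loopToHofiber φ).comp f))
    · intro h
      exact h.comp_left e'
  · constructor
    · intro h
      have : ((hofiberProj φ).comp (e.comp f)).NullHomotopic := h.congr (hj.comp_right f)
      obtain ⟨g, hg⟩ := (isCoexact_loopToHofiber φ _ _).1 this
      exact ⟨g, (hg.comp_left e').trans (he'e.comp_right f)⟩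
    · rintro ⟨g, hg⟩
      have h₁ : (e.comp f).LiftsUpToHomotopy (loopToHofiber φ) :=
        ⟨g, (hee'.symm.comp_right ((loopToHofiber φ).comp g)).trans (hg.comp_left e)⟩
      exact ((isCoexact_loopToHofiber φ _ _).2 h₁).congr (hj.symm.comp_right f)

/-! ### Reduced suspension and the suspension-loop adjunction -/

section susp

/-- The quotient map to the reduced suspension. -/
def suspMk (X : PtdSpace) : C(X × I, susp X) := ⟨Quotient.mk (suspSetoid X), continuous_quot_mk⟩

theorem isQuotientMap_suspMk (X : PtdSpace) : IsQuotientMap (suspMk X) := isQuotientMap_quot_mk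

theorem suspMk_eq_suspMk {X : PtdSpace} {p q : X × I} :
    suspMk X p = suspMk X q ↔ p = q ∨ (p ∈ suspBase X ∧ q ∈ suspBase X) :=
  Quotient.eq (r := suspSetoid X)

theorem suspMk_eq_pt {X : PtdSpace} {p : X × I} (hp : p ∈ suspBase X) :
    suspMk X p = (susp X).pt :=
  suspMk_eq_suspMk.2 (Or.inr ⟨hp, Or.inl rfl⟩)

/-- The map on the reduced suspension of `X` given by a map on `X × I` that is constant on
`suspBase X`. -/
def suspLift {X : PtdSpace} {T : Type*} [TopologicalSpace T] (G : C(X × I, T)) (t₀ : T)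
    (h : ∀ p ∈ suspBase X, G p = t₀) : C(susp X, T) where
  toFun := Quotient.lift G fun p q hpq => by
    rcases hpq with rfl | ⟨hp, hq⟩
    · rfl
    · rw [h p hp, h q hq]
  continuous_toFun := G.continuous.quotient_lift _

/-- The map of reduced suspensions induced by a pointed map. -/
def suspMap {X Y : PtdSpace} (f : Map X Y) : Map (susp X) (susp Y) where
  toFun := suspLift ((suspMk Y).comp (f.toFun.prodMap (ContinuousMap.id I))) (susp Y).pt (by
    rintro p hp
    refine suspMk_eq_pt (hp.imp_left fun h => ?_)
    exact (congrArg f.toFun h).trans f.map_pt)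
  map_pt := suspMk_eq_pt (Or.inl f.map_pt)

theorem suspMap_suspMk {X Y : PtdSpace} (f : Map X Y) (x : X) (t : I) :
    (suspMap f).toFun (suspMk X (x, t)) = suspMk Y (f.toFun x, t) := rfl

theorem suspMap_injective {X Y : PtdSpace} {f : Map X Y} (hf : Function.Injective f.toFun) :
    Function.Injective (suspMap f).toFun := by
  intro a b hab
  obtain ⟨⟨x, s⟩, rfl⟩ := (isQuotientMap_suspMk X).surjective a
  obtain ⟨⟨y, t⟩, rfl⟩ := (isQuotientMap_suspMk X).surjective b
  have hpt (z : X) (u : I) (h : (f.toFun z, u) ∈ suspBase Y) : (z, u) ∈ suspBase X :=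
    h.imp_left fun h => hf ((show f.toFun z = Y.pt from h).trans f.map_pt.symm)
  rw [suspMap_suspMk, suspMap_suspMk, suspMk_eq_suspMk] at hab
  refine suspMk_eq_suspMk.2 (hab.imp (fun h => ?_) fun h => ⟨hpt x s h.1, hpt y t h.2⟩)
  rw [Prod.mk.injEq] at h
  rw [hf h.1, h.2]

/-- The adjunction between reduced suspensions and loop spaces. -/
def suspAdj {X Y : PtdSpace} (f : Map (susp X) Y) : Map X (loop Y) :=
  toLoop (f.toFun.comp (suspMk X))
    (fun _ => (congrArg f.toFun (suspMk_eq_pt (Or.inr (Or.inl rfl)))).trans f.map_pt)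
    (fun _ => (congrArg f.toFun (suspMk_eq_pt (Or.inr (Or.inr rfl)))).trans f.map_pt)
    (fun _ => (congrArg f.toFun (suspMk_eq_pt (Or.inl rfl))).trans f.map_pt)

theorem ofLoop_eq_pt_of_mem_suspBase {X Y : PtdSpace} (g : Map X (loop Y)) {p : X × I}
    (hp : p ∈ suspBase X) : g.ofLoop p = Y.pt := by
  obtain ⟨x, t⟩ := p
  obtain h | h | h := hp
  · obtain rfl : x = X.pt := h
    exact ofLoop_pt g t
  · obtain rfl : t = 0 := h
    exact ofLoop_zero g x
  · obtain rfl : t = 1 := h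
    exact ofLoop_one g x

theorem suspAdj_surjective {X Y : PtdSpace} :
    Function.Surjective (suspAdj : Map (susp X) Y → Map X (loop Y)) := fun g =>
  ⟨⟨suspLift g.ofLoop Y.pt fun _ => ofLoop_eq_pt_of_mem_suspBase g,
    ofLoop_eq_pt_of_mem_suspBase g (Or.inl rfl)⟩, rfl⟩

theorem suspAdj_homotopic_iff {X Y : PtdSpace} {f g : Map (susp X) Y} :
    (suspAdj f).Homotopic (suspAdj g) ↔ f.Homotopic g := by
  constructor
  · intro h
    obtain ⟨H, h₀, h₁, hpt⟩ := h.exists_continuous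
    -- The homotopy parameter is curried, so that only a map from `X × I` to `C(I, Y)` has to
    -- descend to the quotient; evaluation is continuous because `I` is locally compact.
    let Γ : C((X × I) × I, Y) := ⟨fun q => (H (q.2, q.1.1)).1 q.1.2, by
      have : Continuous fun q => (H q).1 := continuous_subtype_val.comp H.continuous
      fun_prop⟩
    have hΓ : ∀ p ∈ suspBase X, Γ.curry p = ContinuousMap.const I Y.pt := by
      rintro ⟨x, t⟩ hp
      ext s
      change (H (s, x)).1 t = Y.pt
      obtain h | h | h := hp
      · obtain rfl : x = X.pt := h
        rw [hpt]; rfl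
      · obtain rfl : t = 0 := h
        exact (H (s, x)).2.1
      · obtain rfl : t = 1 := h
        exact (H (s, x)).2.2
    refine Homotopic.of_continuous (fun q => suspLift Γ.curry _ hΓ q.2 q.1) (by fun_prop)
      (fun z => ?_) (fun z => ?_) (fun s => ?_)
    · obtain ⟨⟨x, t⟩, rfl⟩ := (isQuotientMap_suspMk X).surjective z
      change (H (0, x)).1 t = _
      rw [h₀]; rfl
    · obtain ⟨⟨x, t⟩, rfl⟩ := (isQuotientMap_suspMk X).surjective z
      change (H (1, x)).1 t = _
      rw [h₁]; rfl
    · exact DFunLike.congr_fun (hΓ (X.pt, 0) (Or.inl rfl)) s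
  · intro h
    obtain ⟨H, h₀, h₁, hpt⟩ := h.exists_continuous
    have hH (s) {p : X × I} (hp : p ∈ suspBase X) : H (s, suspMk X p) = Y.pt := by
      rw [suspMk_eq_pt hp, hpt]
    exact homotopic_of_ofLoop (fun q => H (q.1.1, suspMk X (q.1.2, q.2))) (by fun_prop)
      (fun _ _ => h₀ _) (fun _ _ => h₁ _) (fun s t => hH s (Or.inl rfl))
      (fun q => hH q.1 (Or.inr (Or.inl rfl))) (fun q => hH q.1 (Or.inr (Or.inr rfl)))

/-- The adjoint of `φ.comp k` is `(loopMap φ).comp (suspAdj k)` by definition. -/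
theorem suspAdj_liftsUpToHomotopy_iff {X B Y : PtdSpace} (φ : Map B Y) (f : Map (susp X) Y) :
    (suspAdj f).LiftsUpToHomotopy (loopMap φ) ↔ f.LiftsUpToHomotopy φ := by
  constructor
  · rintro ⟨g, hg⟩
    obtain ⟨k, rfl⟩ := suspAdj_surjective g
    exact ⟨k, suspAdj_homotopic_iff.1 hg⟩
  · rintro ⟨k, hk⟩
    exact ⟨suspAdj k, suspAdj_homotopic_iff.2 hk⟩

theorem suspAdj_comp_suspMap {X X' Y : PtdSpace} (f : Map (susp X) Y) (i : Map X' X) :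
    suspAdj (f.comp (suspMap i)) = (suspAdj f).comp i := rfl

instance {X : PtdSpace} [CompactSpace X] : CompactSpace (susp X) :=
  (isQuotientMap_suspMk X).surjective.compactSpace (suspMk X).continuous

end susp

/-! ### Compactness and comparison of skeleta -/

/-- A compact set lies in a member of an exhaustion `S` if all sequences which leave the exhaustion
have closed tails. -/
theorem exists_subset_of_isCompact {T : Type*} [TopologicalSpace T] {S : ℕ → Set T}
    (hmono : Monotone S) (hS : ⋃ n, S n = univ)
    (hcl : ∀ y : ℕ → T, (∀ n, y n ∉ S n) → ∀ n, IsClosed (y '' Ici n))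
    {C : Set T} (hC : IsCompact C) : ∃ n, C ⊆ S n := by
  by_contra! h
  simp only [not_subset] at h
  choose y hyC hyS using h
  -- A point common to all tails lies in some `S n`, yet equals `y m` for some `m ≥ n`, which is
  -- outside `S m ⊇ S n`.
  have hne : (⋂ n, y '' Ici n).Nonempty :=
    IsCompact.nonempty_iInter_of_sequence_nonempty_isCompact_isClosed _
      (fun n => image_mono (Ici_subset_Ici.2 n.le_succ)) (fun n => nonempty_Ici.image y)
      (hC.of_isClosed_subset (hcl y hyS 0) (image_subset_iff.2 fun n _ => hyC n)) (hcl y hyS)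
  obtain ⟨z, hz⟩ := hne
  obtain ⟨n, hn⟩ := mem_iUnion.1 (hS.symm ▸ mem_univ z : z ∈ ⋃ n, S n)
  obtain ⟨m, hm, rfl⟩ := mem_iInter.1 hz n
  exact hyS m (hmono hm hn)

namespace CWStructure

variable {X : PtdSpace} (K : CWStructure X)

theorem skelSet_mono : Monotone K.skelSet := by
  intro m n hmn
  let := K.t2
  let := K.cw
  exact CWComplex.skeleton_mono (C := (univ : Set X)) (by exact_mod_cast hmn)

theorem iUnion_skelSet : ⋃ n, K.skelSet n = univ := by
  let := K.t2
  let := K.cw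
  exact CWComplex.iUnion_skeleton_eq_complex (C := (univ : Set X))

theorem isCompact_skelSet (n : ℕ) : IsCompact (K.skelSet n) := by
  let := K.t2
  let := K.cw
  -- The `n`-skeleton is by definition the union of the cells of dimension less than `n + 1`, a
  -- finite union by finite type.
  change IsCompact (RelCWComplex.skeletonLT (univ : Set X) ((n : ℕ∞) + 1) : Set X)
  rw [RelCWComplex.coe_skeletonLT, empty_union]
  have h : {m : ℕ | (m : ℕ∞) < (n : ℕ∞) + 1}.Finite :=
    (finite_Iio (n + 1)).subset fun m hm => by exact_mod_cast hm
  refine h.isCompact_biUnion fun m _ => ?_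
  have := K.finiteType.finite_cell m
  exact isCompact_iUnion fun j => RelCWComplex.isCompact_closedCell

instance (n : ℕ) : CompactSpace (K.skel n) := isCompact_iff_compactSpace.1 (K.isCompact_skelSet n)

/-- A closed `m`-cell lies in the `m`-skeleton, so it contains `y k` only for `k < m`: the set meets
each closed cell in a finite set. -/
theorem isClosed_image_Ici {y : ℕ → X} (hy : ∀ n, y n ∉ K.skelSet n) (n : ℕ) :
    IsClosed (y '' Ici n) := by
  let := K.t2
  let := K.cw
  rw [CWComplex.closed (univ : Set X) _ (subset_univ _)]
  intro m j
  refine (((finite_Iio m).image y).subset ?_).isClosed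
  rintro _ ⟨⟨k, -, rfl⟩, hk⟩
  refine ⟨k, lt_of_not_ge fun hmk => hy k (K.skelSet_mono hmk ?_), rfl⟩
  exact CWComplex.closedCell_subset_skeleton m j hk

theorem exists_subset_skelSet {C : Set X} (hC : IsCompact C) : ∃ n, C ⊆ K.skelSet n :=
  exists_subset_of_isCompact K.skelSet_mono K.iUnion_skelSet
    (fun _ hy => K.isClosed_image_Ici hy) hC

theorem mem_range_suspMap_incl {n : ℕ} {x : X} {t : I} :
    suspMk X (x, t) ∈ range (suspMap (K.incl n)).toFun ↔
      x ∈ K.skelSet n ∨ (x, t) ∈ suspBase X := by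
  constructor
  · rintro ⟨a, ha⟩
    obtain ⟨⟨y, s⟩, rfl⟩ := (isQuotientMap_suspMk (K.skel n)).surjective a
    rw [suspMap_suspMk, suspMk_eq_suspMk, Prod.mk.injEq] at ha
    exact ha.imp (fun h => by rw [← h.1]; exact y.2) And.right
  · rintro (h | h)
    · exact ⟨suspMk (K.skel n) (⟨x, h⟩, t), rfl⟩
    · exact ⟨(susp _).pt, (suspMap (K.incl n)).map_pt.trans (suspMk_eq_pt h).symm⟩

/-- No CW structure on the suspension is used: closedness of tails is checked in `X × I`, where it
follows from closedness of tails in `X`. -/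
theorem exists_subset_range_suspMap_incl {C : Set (susp X)} (hC : IsCompact C) :
    ∃ n, C ⊆ range (suspMap (K.incl n)).toFun := by
  have := K.t2
  refine exists_subset_of_isCompact (S := fun n => range (suspMap (K.incl n)).toFun) ?_ ?_ ?_ hC
  · intro m n hmn a
    obtain ⟨⟨x, t⟩, rfl⟩ := (isQuotientMap_suspMk X).surjective a
    simp only [mem_range_suspMap_incl]
    exact Or.imp_left fun h => K.skelSet_mono hmn h
  · refine eq_univ_of_forall fun a => ?_
    obtain ⟨⟨x, t⟩, rfl⟩ := (isQuotientMap_suspMk X).surjective a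
    obtain ⟨n, hn⟩ := mem_iUnion.1 (K.iUnion_skelSet.symm ▸ mem_univ x : x ∈ ⋃ n, K.skelSet n)
    exact mem_iUnion.2 ⟨n, K.mem_range_suspMap_incl.2 (Or.inl hn)⟩
  · intro y hy n
    choose p hp using fun k => (isQuotientMap_suspMk X).surjective (y k)
    have hpk (k) : (p k).1 ∉ K.skelSet k ∧ p k ∉ suspBase X := by
      have := hy k
      rwa [← hp k, mem_range_suspMap_incl, not_or] at this
    rw [← (isQuotientMap_suspMk X).isClosed_preimage]
    -- The points avoid the collapsed part, so each has a single preimage.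
    have heq : suspMk X ⁻¹' (y '' Ici n) = ⋃ k : Ici n, {p k} := by
      ext q
      simp only [mem_preimage, mem_image, mem_iUnion, mem_singleton_iff, Subtype.exists,
        exists_prop, ← hp]
      refine exists_congr fun k => and_congr_right fun _ => ?_
      rw [suspMk_eq_suspMk]
      exact ⟨fun h => (h.resolve_right fun h => (hpk k).2 h.1).symm, fun h => Or.inl h.symm⟩
    rw [heq]
    refine LocallyFinite.isClosed_iUnion ?_ fun _ => isClosed_singleton
    rintro ⟨x, t⟩
    obtain ⟨m, hm⟩ := mem_iUnion.1 (K.iUnion_skelSet.symm ▸ mem_univ x : x ∈ ⋃ n, K.skelSet n)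
    -- As `x` lies in the `m`-skeleton, the first coordinates with index at least `m` form a closed
    -- set missing `x`; its complement gives a neighborhood meeting only finitely many of the
    -- points.
    have hcl := K.isClosed_image_Ici (y := fun k => (p k).1) (fun k => (hpk k).1) m
    refine ⟨Prod.fst ⁻¹' ((fun k => (p k).1) '' Ici m)ᶜ,
      (hcl.isOpen_compl.preimage continuous_fst).mem_nhds ?_, ?_⟩
    · rintro ⟨k, hk, rfl⟩
      exact (hpk k).1 (K.skelSet_mono hk hm)
    · refine ((finite_Iio m).preimage Subtype.val_injective.injOn).subset ?_
      rintro ⟨k, _⟩ ⟨q, rfl, hq⟩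
      exact lt_of_not_ge fun hk : m ≤ k => hq ⟨k, hk, rfl⟩

/-- The skeleta of `L` and the suspended skeleta of `K` are compact and cofinal in one another, and
lifts restrict. -/
theorem isRelPhantom_susp_iff (L : CWStructure (susp X)) {B Y : PtdSpace} (φ : Map B Y)
    (f : Map (susp X) Y) :
    L.IsRelPhantom φ f ↔ ∀ n, (f.comp (suspMap (K.incl n))).LiftsUpToHomotopy φ := by
  have := L.t2
  constructor
  · intro h n
    obtain ⟨m, hm⟩ := L.exists_subset_skelSet
      (isCompact_range (suspMap (K.incl n)).toFun.continuous)
    let k : Map (susp (K.skel n)) (L.skel m) :=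
      ⟨⟨fun a => ⟨(suspMap (K.incl n)).toFun a, hm (mem_range_self a)⟩,
        (suspMap (K.incl n)).toFun.continuous.subtype_mk _⟩, Subtype.ext (suspMap (K.incl n)).map_pt⟩
    exact (h m).comp_right k
  · intro h n
    obtain ⟨m, hm⟩ := K.exists_subset_range_suspMap_incl (L.isCompact_skelSet n)
    -- A continuous injection from a compact space to a Hausdorff one is an embedding, so the
    -- pointwise factorization `k` is continuous.
    have hemb : IsClosedEmbedding (suspMap (K.incl m)).toFun :=
      (suspMap (K.incl m)).toFun.continuous.isClosedEmbedding
        (suspMap_injective Subtype.val_injective)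
    choose k hk using fun a : L.skelSet n => hm a.2
    let k' : Map (L.skel n) (susp (K.skel m)) :=
      ⟨⟨k, hemb.isInducing.continuous_iff.2 (continuous_subtype_val.congr fun a => (hk a).symm)⟩,
        hemb.injective ((hk _).trans (suspMap (K.incl m)).map_pt.symm)⟩
    have hk' : (suspMap (K.incl m)).comp k' = L.incl n := Map.ext hk
    rw [← hk']
    exact (h m).comp_right k'

theorem relPhTrivial_susp_iff (L : CWStructure (susp X)) {B Y : PtdSpace} (φ : Map B Y) :
    L.RelPhTrivial φ ↔ K.RelPhTrivial (loopMap φ) := by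
  rw [L.relPhTrivial_iff, K.relPhTrivial_iff, suspAdj_surjective.forall]
  refine forall_congr' fun f => ?_
  rw [K.isRelPhantom_susp_iff, suspAdj_liftsUpToHomotopy_iff]
  refine imp_congr_left (forall_congr' fun n => ?_)
  rw [← suspAdj_comp_suspMap, suspAdj_liftsUpToHomotopy_iff]

end CWStructure

end PtdSpace

open PtdSpace in
theorem proposition4p7 (X : PtdSpace) (K : CWStructure X) :
    (∀ (B Y V W : PtdSpace) (φ : Map B Y) (α : Map Y V) (β : Map V W),
      IsHomotopyFibration φ α → IsHomotopyFibration α β →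
      (β.NullHomotopic ∨ K.PhEqPoint W) →
      (K.RelPhTrivial φ ↔ K.PhEqPoint V)) ∧
    (∀ (L : CWStructure (susp X)) (F B Y : PtdSpace) (j : Map F B) (φ : Map B Y),
      IsHomotopyFibration j φ →
      (j.NullHomotopic ∨ K.PhEqPoint B) →
      (L.RelPhTrivial φ ↔ K.PhEqPoint F)) := by

  exact ⟨fun _ _ _ _ _ _ _ h₁ h₂ h => K.relPhTrivial_iff_phEqPoint h₁.isCoexact h₂.isCoexact h,
    fun L _ _ _ _ φ hφ h => by
      obtain ⟨δ, h₁, h₂⟩ := hφ.exists_isCoexact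
      exact (K.relPhTrivial_susp_iff L φ).trans (K.relPhTrivial_iff_phEqPoint h₁ h₂ h)⟩
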